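/- Let $E$ be a real reflexive Banach space with dual $E^*$, let $\varphi : E \to [0,\infty]$ be proper (i.e. $\varphi \not\equiv \infty$), lower semicontinuous and convex, let $\alpha, \mu > 0$, and put $$\Phi(u) := \varphi(u) + \frac{\mu}{1+\alpha}\,\varphi(u)^{1+\alpha}, \qquad u \in E,$$ where $\infty^{1+\alpha} = \infty$. For $\psi : E \to [0,\infty]$ write $D(\psi) := \{u \in E : \psi(u) < \infty\}$, let $$\partial\psi(u) := \{\eta \in E^* : \psi(v) \ge \psi(u) + \langle \eta, v-u\rangle \ \text{ for all } v \in D(\psi)\}$$ be its subdifferential at $u \in E$, and write $D(\partial\psi) := \{u \in E : \partial\psi(u) \ne \varnothing\}$. Then $$D(\Phi) = D(\varphi), \qquad D(\partial\Phi) = D(\partial\varphi),$$ and $$\partial\Phi(u) = (1+\mu\,\varphi(u)^{\alpha})\,\partial\varphi(u) := \{(1+\mu\,\varphi(u)^{\alpha})\,\eta : \eta \in \partial\varphi(u)\} \qquad \text{for all } u \in D(\partial\varphi).$$ -/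

import Mathlib

open Set
open scoped ENNReal NNReal Pointwise

/-- A real Banach space is reflexive when its canonical embedding into the bidual is onto. -/
def IsReflexiveSpace (E : Type*) [NormedAddCommGroup E] [NormedSpace ℝ E] : Prop :=
  Function.Surjective (NormedSpace.inclusionInDoubleDual ℝ E)

/-- The effective domain of a functional with values in `[0, ∞]`. -/
def effectiveDomain {E : Type*} (φ : E → ℝ≥0∞) : Set E :=
  {u | φ u < ∞}

/-- The subdifferential of `φ` at `u`: all `η` in the topological dual of `E` such that
`φ v ≥ φ u + ⟨η, v - u⟩` for every `v` in the effective domain of `φ`.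
The inequality is read in the extended reals. -/
def subdifferential {E : Type*} [NormedAddCommGroup E] [NormedSpace ℝ E]
    (φ : E → ℝ≥0∞) (u : E) : Set (StrongDual ℝ E) :=
  {η | ∀ v ∈ effectiveDomain φ, (φ u : EReal) + ((η (v - u) : ℝ) : EReal) ≤ (φ v : EReal)}

/-- The domain `{u | A u ≠ ∅}` of a multivalued operator. -/
def operatorDomain {E F : Type*} (A : E → Set F) : Set E :=
  {u | (A u).Nonempty}

/-- The functional `Φ = φ + μ / (1 + α) * φ ^ (1 + α)`. -/
noncomputable def powerPerturbation {E : Type*} (α μ : ℝ) (φ : E → ℝ≥0∞) (u : E) : ℝ≥0∞ :=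
  φ u + ENNReal.ofReal (μ / (1 + α)) * φ u ^ (1 + α)

/-! Where `φ` is finite, Φ = g ∘ φ with g convex and increasing on [0, ∞) and g'(s) = 1 + μ s^α > 0.
For η ∈ ∂φ(u), the tangent line of g at φ(u) gives g'(φ(u)) η ∈ ∂Φ(u). Conversely, if g'(φ(u)) η ∈
∂Φ(u), test it at u + t(v - u): convexity bounds `φ` there by its chord, and t → 0⁺ gives η ∈ ∂φ(u)
after cancelling g'(φ(u)). As g' ≠ 0, every functional has the form g'(φ(u)) η, so the two sets
agree. -/

/-- The scalar function `s ↦ s + μ / (1 + α) * s ^ (1 + α)`, with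
`powerPerturbation α μ φ = scalarPerturbation α μ ∘ φ` where `φ` is finite. -/
noncomputable def scalarPerturbation (α μ s : ℝ) : ℝ :=
  s + μ / (1 + α) * s ^ (1 + α)

theorem hasDerivAt_scalarPerturbation {α : ℝ} (hα : 0 < α) (μ a : ℝ) :
    HasDerivAt (scalarPerturbation α μ) (1 + μ * a ^ α) a := by
  have h := (hasDerivAt_id a).add
    -- The exponent is at least 1, so `a = 0` is allowed; this covers minimizers with φ(u) = 0.
    ((Real.hasDerivAt_rpow_const (x := a) (p := 1 + α) (Or.inr (by linarith))).const_mul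
      (μ / (1 + α)))
  have h1 : (1 + α) ≠ 0 := by positivity
  convert! h using 1
  rw [add_sub_cancel_left]
  field_simp

theorem convexOn_scalarPerturbation {α μ : ℝ} (hα : 0 < α) (hμ : 0 < μ) :
    ConvexOn ℝ (Ici 0) (scalarPerturbation α μ) :=
  (convexOn_id (convex_Ici 0)).add
    ((convexOn_rpow (by linarith : (1 : ℝ) ≤ 1 + α)).smul (by positivity : 0 ≤ μ / (1 + α)))

theorem scalarPerturbation_mono {α μ : ℝ} (hα : 0 < α) (hμ : 0 < μ) {s t : ℝ} (hs : 0 ≤ s)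
    (hst : s ≤ t) : scalarPerturbation α μ s ≤ scalarPerturbation α μ t := by
  unfold scalarPerturbation
  gcongr

/-- A linear lower bound along a ray bounds the one-sided derivative from below. -/
theorem le_deriv_mul_of_forall_le {g : ℝ → ℝ} {a c d e : ℝ} (hg : HasDerivAt g d a)
    (h : ∀ t ∈ Ioc (0 : ℝ) 1, g a + t * e ≤ g (a + t * c)) : e ≤ d * c := by
  have hl : HasDerivAt (fun t : ℝ => a + t * c) c 0 := by
    simpa using ((hasDerivAt_id (0 : ℝ)).mul_const c).const_add a
  have hg0 : HasDerivAt g d (a + 0 * c) := by simpa using hg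
  have hd : HasDerivAt (fun t : ℝ => g (a + t * c)) (d * c) 0 := hg0.comp 0 hl
  refine ge_of_tendsto hd.tendsto_slope_zero_right ?_
  filter_upwards [Ioc_mem_nhdsGT (zero_lt_one' ℝ)] with t ht
  have ht0 : 0 < t := ht.1
  have := h t ht
  simp only [zero_add, zero_mul, add_zero, smul_eq_mul]
  rw [inv_mul_eq_div, le_div_iff₀ ht0]
  linarith

/-- A convex function lies above its tangent lines. -/
theorem ConvexOn.add_deriv_mul_sub_le {S : Set ℝ} {g : ℝ → ℝ} (hc : ConvexOn ℝ S g) {a b d : ℝ}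
    (ha : a ∈ S) (hb : b ∈ S) (hg : HasDerivAt g d a) : g a + d * (b - a) ≤ g b := by
  -- Applied to `-g`: the chord bounds `g` from above, hence `-g` from below.
  have := le_deriv_mul_of_forall_le (c := b - a) (e := g a - g b) hg.neg fun t ht => by
    have h := hc.2 ha hb (sub_nonneg.2 ht.2) ht.1.le (by ring)
    simp only [smul_eq_mul] at h
    rw [show (1 - t) * a + t * b = a + t * (b - a) by ring] at h
    simp only [Pi.neg_apply]
    linarith
  linarith

theorem powerPerturbation_ne_top_iff {E : Type*} {α μ : ℝ} (hα : 0 < α) {φ : E → ℝ≥0∞} {u : E} :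
    powerPerturbation α μ φ u ≠ ∞ ↔ φ u ≠ ∞ := by
  refine ⟨fun h hu => h (by simp [powerPerturbation, hu]), fun hu => ?_⟩
  exact ENNReal.add_ne_top.2 ⟨hu, ENNReal.mul_ne_top ENNReal.ofReal_ne_top
    (ENNReal.rpow_ne_top_of_nonneg (by positivity) hu)⟩

theorem toReal_powerPerturbation {E : Type*} {α μ : ℝ} (hα : 0 < α) (hμ : 0 < μ) {φ : E → ℝ≥0∞} {u : E}
    (hu : φ u ≠ ∞) :
    (powerPerturbation α μ φ u).toReal = scalarPerturbation α μ (φ u).toReal := by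
  rw [powerPerturbation, ENNReal.toReal_add hu (ENNReal.mul_ne_top ENNReal.ofReal_ne_top
    (ENNReal.rpow_ne_top_of_nonneg (by positivity) hu)), ENNReal.toReal_mul,
    ENNReal.toReal_ofReal (by positivity), ← ENNReal.toReal_rpow, scalarPerturbation]

section Functional

variable {E : Type*} [NormedAddCommGroup E] [NormedSpace ℝ E]

/-- If φ(u) = ∞, the subgradient inequality fails at any point where `φ` is finite. -/
theorem ne_top_of_mem_subdifferential {φ : E → ℝ≥0∞} (hφ : ∃ v, φ v ≠ ∞) {u : E}
    {η : StrongDual ℝ E} (h : η ∈ subdifferential φ u) : φ u ≠ ∞ := by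
  intro hu
  obtain ⟨v, hv⟩ := hφ
  have := h v (lt_top_iff_ne_top.2 hv)
  rw [hu, EReal.coe_ennreal_top, EReal.top_add_coe, top_le_iff, EReal.coe_ennreal_eq_top_iff] at this
  exact hv this

/-- The subdifferential at a point of the effective domain, in terms of real values. -/
theorem mem_subdifferential_iff {φ : E → ℝ≥0∞} {u : E} (hu : φ u ≠ ∞) {η : StrongDual ℝ E} :
    η ∈ subdifferential φ u ↔ ∀ v, φ v ≠ ∞ → (φ u).toReal + η (v - u) ≤ (φ v).toReal := by
  refine forall_congr' fun v => ?_
  rw [effectiveDomain, mem_ofPred_eq, lt_top_iff_ne_top]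
  refine imp_congr_right fun hv => ?_
  rw [← EReal.coe_ennreal_toReal hu, ← EReal.coe_ennreal_toReal hv, ← EReal.coe_add,
    EReal.coe_le_coe_iff]

theorem ne_top_and_toReal_le_of_convexOn {φ : E → ℝ≥0∞} (hconv : ConvexOn ℝ≥0 univ φ) {u v : E}
    (hu : φ u ≠ ∞) (hv : φ v ≠ ∞) {t : ℝ} (ht : t ∈ Icc (0 : ℝ) 1) :
    φ (u + t • (v - u)) ≠ ∞ ∧
      (φ (u + t • (v - u))).toReal ≤ (φ u).toReal + t * ((φ v).toReal - (φ u).toReal) := by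
  lift t to ℝ≥0 using ht.1
  have ht1 : t ≤ 1 := by exact_mod_cast ht.2
  have h := hconv.2 (mem_univ u) (mem_univ v) (zero_le (a := 1 - t)) (zero_le (a := t))
    (tsub_add_cancel_of_le ht1)
  have hcomb : (1 - t) • u + t • v = u + (t : ℝ) • (v - u) := by
    rw [NNReal.smul_def, NNReal.smul_def, NNReal.coe_sub ht1, NNReal.coe_one]
    module
  rw [hcomb, ENNReal.smul_def, ENNReal.smul_def, smul_eq_mul, smul_eq_mul] at h
  have h1 := ENNReal.mul_ne_top (ENNReal.coe_ne_top (r := 1 - t)) hu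
  have h2 := ENNReal.mul_ne_top (ENNReal.coe_ne_top (r := t)) hv
  have hr := ENNReal.add_ne_top.2 ⟨h1, h2⟩
  refine ⟨ne_top_of_le_ne_top hr h, ?_⟩
  have h' := ENNReal.toReal_mono hr h
  rw [ENNReal.toReal_add h1 h2, ENNReal.toReal_mul, ENNReal.toReal_mul, ENNReal.coe_toReal,
    ENNReal.coe_toReal, NNReal.coe_sub ht1, NNReal.coe_one] at h'
  linarith

/-- The chain rule for the subdifferential of `powerPerturbation`. -/
theorem smul_mem_subdifferential_powerPerturbation_iff {α μ : ℝ} (hα : 0 < α) (hμ : 0 < μ)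
    {φ : E → ℝ≥0∞} (hconv : ConvexOn ℝ≥0 univ φ) {u : E} (hu : φ u ≠ ∞) {η : StrongDual ℝ E} :
    (1 + μ * (φ u).toReal ^ α) • η ∈ subdifferential (powerPerturbation α μ φ) u ↔
      η ∈ subdifferential φ u := by
  have hpos : 0 < 1 + μ * (φ u).toReal ^ α := by positivity
  have hderiv := hasDerivAt_scalarPerturbation hα μ (φ u).toReal
  rw [mem_subdifferential_iff hu,
    mem_subdifferential_iff ((powerPerturbation_ne_top_iff hα).2 hu)]
  simp only [powerPerturbation_ne_top_iff hα, smul_apply, smul_eq_mul]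
  refine ⟨fun h v hv => ?_, fun h v hv => ?_⟩
  · have key := le_deriv_mul_of_forall_le (c := (φ v).toReal - (φ u).toReal) hderiv fun t ht => by
      obtain ⟨hw, hle⟩ := ne_top_and_toReal_le_of_convexOn hconv hu hv ⟨ht.1.le, ht.2⟩
      have hη := h _ hw
      rw [toReal_powerPerturbation hα hμ hu, toReal_powerPerturbation hα hμ hw,
        add_sub_cancel_left, map_smul, smul_eq_mul, mul_left_comm] at hη
      -- Monotonicity of g carries the chord bound on `φ` over to Φ.
      exact hη.trans (scalarPerturbation_mono hα hμ ENNReal.toReal_nonneg hle)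
    linarith [le_of_mul_le_mul_left key hpos]
  · have key := (convexOn_scalarPerturbation hα hμ).add_deriv_mul_sub_le
      (mem_Ici.2 ENNReal.toReal_nonneg) (mem_Ici.2 (ENNReal.toReal_nonneg (a := φ v))) hderiv
    rw [toReal_powerPerturbation hα hμ hu, toReal_powerPerturbation hα hμ hv]
    have := mul_le_mul_of_nonneg_left (by linarith [h v hv] :
      η (v - u) ≤ (φ v).toReal - (φ u).toReal) hpos.le
    linarith

theorem subdifferential_powerPerturbation {α μ : ℝ} (hα : 0 < α) (hμ : 0 < μ)
    {φ : E → ℝ≥0∞} (hconv : ConvexOn ℝ≥0 univ φ) {u : E} (hu : φ u ≠ ∞) :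
    subdifferential (powerPerturbation α μ φ) u =
      (1 + μ * (φ u).toReal ^ α) • subdifferential φ u := by
  have hpos : 0 < 1 + μ * (φ u).toReal ^ α := by positivity
  ext η
  rw [mem_smul_set_iff_inv_smul_mem₀ hpos.ne',
    ← smul_mem_subdifferential_powerPerturbation_iff hα hμ hconv hu, smul_inv_smul₀ hpos.ne']

end Functional

theorem mainTheorem6 {E : Type*} [NormedAddCommGroup E] [NormedSpace ℝ E] [CompleteSpace E]
    (hE : IsReflexiveSpace E) (φ : E → ℝ≥0∞)
    (hproper : ∃ u, φ u ≠ ∞) (hlsc : LowerSemicontinuous φ) (hconv : ConvexOn ℝ≥0 univ φ)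
    (α μ : ℝ) (hα : 0 < α) (hμ : 0 < μ) :
    effectiveDomain (powerPerturbation α μ φ) = effectiveDomain φ ∧
    operatorDomain (subdifferential (powerPerturbation α μ φ)) =
      operatorDomain (subdifferential φ) ∧
    ∀ u ∈ operatorDomain (subdifferential φ),
      subdifferential (powerPerturbation α μ φ) u =
        (1 + μ * (φ u).toReal ^ α) • subdifferential φ u := by
  have htop : ∀ u, powerPerturbation α μ φ u ≠ ∞ ↔ φ u ≠ ∞ :=
    fun u => powerPerturbation_ne_top_iff hα
  have hproper' : ∃ u, powerPerturbation α μ φ u ≠ ∞ := hproper.imp fun u => (htop u).2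
  refine ⟨?_, ?_, ?_⟩
  · ext u
    simpa only [effectiveDomain, mem_ofPred_eq, lt_top_iff_ne_top] using htop u
  · ext u
    constructor
    · rintro ⟨η, hη⟩
      have hu := (htop u).1 (ne_top_of_mem_subdifferential hproper' hη)
      rw [subdifferential_powerPerturbation hα hμ hconv hu] at hη
      exact smul_set_nonempty.1 ⟨η, hη⟩
    · rintro ⟨η, hη⟩
      have hu := ne_top_of_mem_subdifferential hproper hη
      exact ⟨_, (smul_mem_subdifferential_powerPerturbation_iff hα hμ hconv hu).2 hη⟩
  · rintro u ⟨η, hη⟩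
    exact subdifferential_powerPerturbation hα hμ hconv (ne_top_of_mem_subdifferential hproper hη)
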